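/- Let $C$ be a convex body in $\mathbb R^n$ (a nonempty compact convex set), let $u_1,\dots,u_m$ be unit vectors in $\mathbb R^n$ and let $c_1,\dots,c_m$ be positive real numbers such that $$\sum_{i=1}^m c_i\, u_i\otimes u_i = I_n ,$$ where $u_i\otimes u_i$ is the rank-one operator $x\mapsto\langle u_i,x\rangle u_i$ and $I_n$ is the identity on $\mathbb R^n$. For each $i$ let $P_i$ be the orthogonal projection of $\mathbb R^n$ onto the hyperplane $u_i^\perp$. Then $$|C|^{n-1}\le\prod_{i=1}^m |P_iC|^{c_i},$$ where $|C|$ is the $n$-dimensional volume of $C$ and $|P_iC|$ is the $(n-1)$-dimensional volume of $P_iC$ in $u_i^\perp$. -/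

import Mathlib

open MeasureTheory InnerProductSpace

open scoped ENNReal Pointwise RealInnerProductSpace

/-! The body is compared with a zonotope `Z`, the sum of the segments `[-c i * a i, c i * a i]` in
the directions `u i`. Two facts about `Z` carry the proof. Transporting the standard Gaussian into
`Z` gives `|Z| ≥ ∏ (2 * a i) ^ c i` (`prod_rpow_le_volume_zonotope`). If `|C| ≤ |Z|`, Minkowski's
first inequality gives `n|C| ≤ ∑ 2 * c i * a i * |P_i C|`, the right side being `n` times the mixed
volume of `C` (taken `n - 1` times) and `Z`.

With `a i = k / (2|P_i C|)` every summand becomes `c i * k`, and `∑ c i = n` turns the second fact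
into `|C| ≤ k`. Choosing `k ^ n = |C| ∏ |P_i C| ^ c i` makes the first fact read `|Z| ≥ |C|`. Hence
`|C| ^ n ≤ k ^ n`, and dividing by `|C|` gives the claim.

Mixed volumes are avoided: `|C + rZ|` is bounded below by Brunn-Minkowski and above by sweeping
along the segments, and `r` tends to zero. -/

/-! ### Prékopa-Leindler and Brunn-Minkowski inequalities. -/

/-- One-dimensional Brunn-Minkowski inequality for compact sets. -/
lemma volume_add_volume_le_of_isCompact {A B C : Set ℝ} (hA : IsCompact A) (hB : IsCompact B)
    (hA' : A.Nonempty) (hB' : B.Nonempty) (h : ∀ a ∈ A, ∀ b ∈ B, a + b ∈ C) :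
    volume A + volume B ≤ volume C := by
  obtain ⟨a, haA, ha⟩ := hA.exists_isGreatest hA'
  obtain ⟨b, hbB, hb⟩ := hB.exists_isLeast hB'
  -- These translates of `A` and `B` lie on either side of `a + b` and share at most that point.
  have hd : AEDisjoint volume ((fun x => x + b) '' A) ((fun x => a + x) '' B) := by
    refine measure_mono_null (t := {a + b}) ?_ (by simp)
    rintro x ⟨⟨y, hy, rfl⟩, ⟨z, hz, hyz⟩⟩
    have h1 := ha hy
    have h2 := hb hz
    simp only [Set.mem_singleton_iff] at *
    linarith
  have hm : MeasurableSet ((fun x => a + x) '' B) :=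
    (hB.image (by fun_prop)).measurableSet
  calc volume A + volume B
      = volume ((fun x => x + b) '' A) + volume ((fun x => a + x) '' B) := by
        simp [measure_preimage_add, measure_preimage_add_right]
    _ = volume ((fun x => x + b) '' A ∪ (fun x => a + x) '' B) :=
        (measure_union₀ hm.nullMeasurableSet hd).symm
    _ ≤ volume C := by
        apply measure_mono
        rintro x (⟨y, hy, rfl⟩ | ⟨y, hy, rfl⟩)
        · exact h y hy b hbB
        · exact h a haA y hy

lemma volume_add_volume_le {A B C : Set ℝ} (hA : MeasurableSet A) (hB : MeasurableSet B)
    (hA' : A.Nonempty) (hB' : B.Nonempty) (h : ∀ a ∈ A, ∀ b ∈ B, a + b ∈ C) :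
    volume A + volume B ≤ volume C := by
  obtain ⟨a, ha⟩ := hA'
  obtain ⟨b, hb⟩ := hB'
  rw [hA.measure_eq_iSup_isCompact, hB.measure_eq_iSup_isCompact]
  simp only [iSup_and']
  refine ENNReal.biSup_add_biSup_le' (p := fun K : Set ℝ => K ⊆ A ∧ IsCompact K)
    (q := fun K : Set ℝ => K ⊆ B ∧ IsCompact K) ⟨∅, by simp⟩ ⟨∅, by simp⟩ ?_
  rintro K ⟨hKA, hK⟩ L ⟨hLB, hL⟩
  -- The compact approximants may be empty; inserting `a` and `b` makes them nonempty.
  calc volume K + volume L ≤ volume (insert a K) + volume (insert b L) := by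
        gcongr <;> exact Set.subset_insert _ _
    _ ≤ volume C := volume_add_volume_le_of_isCompact (hK.insert a) (hL.insert b)
        (Set.insert_nonempty _ _) (Set.insert_nonempty _ _) fun x hx y hy =>
        h x (Set.insert_subset ha hKA hx) y (Set.insert_subset hb hLB hy)

lemma volume_smul_add_volume_smul_le {s t : ℝ} (hs : 0 < s) (ht : 0 < t) {A B C : Set ℝ}
    (hA : MeasurableSet A) (hB : MeasurableSet B)
    (hA' : A.Nonempty) (hB' : B.Nonempty) (h : ∀ a ∈ A, ∀ b ∈ B, s * a + t * b ∈ C) :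
    ENNReal.ofReal s * volume A + ENNReal.ofReal t * volume B ≤ volume C := by
  have := volume_add_volume_le (A := s • A) (B := t • B) (C := C)
    (hA.const_smul₀ s) (hB.const_smul₀ t) hA'.smul_set hB'.smul_set (by
      rintro _ ⟨a, ha, rfl⟩ _ ⟨b, hb, rfl⟩
      exact h a ha b hb)
  simpa [Measure.addHaar_smul, abs_of_pos hs, abs_of_pos ht] using this

/-- Layer-cake formula; truncation at one confines the levels to `(0, 1)`, where superlevel sets of
a function of supremum one are nonempty. -/
lemma lintegral_min_one_eq {α : Type*} [MeasurableSpace α] (μ : Measure α) {f : α → ℝ≥0∞}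
    (hf : Measurable f) :
    ∫⁻ x, min (f x) 1 ∂μ = ∫⁻ r in Set.Ioo (0 : ℝ) 1, μ {x | ENNReal.ofReal r < f x} := by
  have hfin : ∀ x, min (f x) 1 ≠ ∞ := fun x => (min_le_right _ _).trans_lt ENNReal.one_lt_top |>.ne
  have key := lintegral_eq_lintegral_meas_lt μ (f := fun x => (min (f x) 1).toReal)
    (Filter.Eventually.of_forall fun x => ENNReal.toReal_nonneg)
    (hf.min measurable_const).ennreal_toReal.aemeasurable
  simp only [ENNReal.ofReal_toReal (hfin _)] at key
  rw [key, ← lintegral_indicator measurableSet_Ioi, ← lintegral_indicator measurableSet_Ioo]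
  congr 1
  ext r
  by_cases h0 : 0 < r
  · by_cases h1 : r < 1
    · rw [Set.indicator_of_mem (Set.mem_Ioi.2 h0), Set.indicator_of_mem (Set.mem_Ioo.2 ⟨h0, h1⟩)]
      congr 1
      ext x
      simp only [Set.mem_ofPred_eq]
      rw [← ENNReal.ofReal_lt_iff_lt_toReal h0.le (hfin x), lt_min_iff]
      simp [h1]
    · rw [Set.indicator_of_mem (Set.mem_Ioi.2 h0), Set.indicator_of_notMem (by simp [h1])]
      convert measure_empty (μ := μ)
      rw [Set.eq_empty_iff_forall_notMem]
      intro x hx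
      simp only [Set.mem_ofPred_eq] at hx
      have := ENNReal.toReal_mono ENNReal.one_ne_top (min_le_right (f x) 1)
      simp at this hx
      grind
  · rw [Set.indicator_of_notMem (by simpa using h0), Set.indicator_of_notMem (by simp [h0])]

/-- The one-dimensional Prékopa-Leindler inequality for functions of supremum one. -/
lemma prekopaLeindler_real_of_iSup_eq_one {s t : ℝ} (hs : 0 < s) (ht : 0 < t) (hst : s + t = 1)
    {f g h : ℝ → ℝ≥0∞} (hf : Measurable f) (hg : Measurable g) (hh : Measurable h)
    (hf1 : ⨆ x, f x = 1) (hg1 : ⨆ x, g x = 1)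
    (H : ∀ x y, f x ^ s * g y ^ t ≤ h (s * x + t * y)) :
    ENNReal.ofReal s * (∫⁻ x, f x) + ENNReal.ofReal t * (∫⁻ x, g x) ≤ ∫⁻ x, h x := by
  have hf' : ∫⁻ x, f x = ∫⁻ x, min (f x) 1 := by
    congr 1; ext x; rw [min_eq_left (hf1 ▸ le_iSup f x)]
  have hg' : ∫⁻ x, g x = ∫⁻ x, min (g x) 1 := by
    congr 1; ext x; rw [min_eq_left (hg1 ▸ le_iSup g x)]
  rw [hf', hg']
  refine le_trans ?_ (lintegral_mono fun x => min_le_left (h x) 1)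
  rw [lintegral_min_one_eq _ hf, lintegral_min_one_eq _ hg, lintegral_min_one_eq _ hh,
    ← lintegral_const_mul' _ _ ENNReal.ofReal_ne_top,
    ← lintegral_const_mul' _ _ ENNReal.ofReal_ne_top]
  refine (le_lintegral_add _ _).trans (setLIntegral_mono' measurableSet_Ioo fun r hr => ?_)
  have hr1 : ENNReal.ofReal r < 1 := by simpa using hr.2
  have hr0 : ENNReal.ofReal r ≠ 0 := by simpa using hr.1
  apply volume_smul_add_volume_smul_le hs ht (measurableSet_lt measurable_const hf)
    (measurableSet_lt measurable_const hg)
  · exact lt_iSup_iff.1 (hf1 ▸ hr1)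
  · exact lt_iSup_iff.1 (hg1 ▸ hr1)
  · intro a ha b hb
    refine lt_of_lt_of_le ?_ (H a b)
    calc ENNReal.ofReal r = ENNReal.ofReal r ^ s * ENNReal.ofReal r ^ t := by
          rw [← ENNReal.rpow_add _ _ hr0 ENNReal.ofReal_ne_top, hst, ENNReal.rpow_one]
      _ < f a ^ s * g b ^ t :=
          ENNReal.mul_lt_mul (ENNReal.rpow_lt_rpow ha hs) (ENNReal.rpow_lt_rpow hb ht)

lemma ENNReal.geom_mean_le_arith_mean2_ofReal {s t : ℝ} (hs : 0 < s) (ht : 0 < t) (hst : s + t = 1)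
    (x y : ℝ≥0∞) : x ^ s * y ^ t ≤ ENNReal.ofReal s * x + ENNReal.ofReal t * y := by
  by_cases hx : x = ∞
  · simp [hx, hs]
  by_cases hy : y = ∞
  · simp [hy, ht]
  lift x to NNReal using hx
  lift y to NNReal using hy
  rw [← ENNReal.coe_rpow_of_nonneg _ hs.le, ← ENNReal.coe_rpow_of_nonneg _ ht.le, ENNReal.ofReal,
    ENNReal.ofReal]
  norm_cast
  have h1 : s.toNNReal + t.toNNReal = 1 := by
    rw [← Real.toNNReal_add hs.le ht.le, hst, Real.toNNReal_one]
  simpa [hs.le, ht.le] using NNReal.geom_mean_le_arith_mean2_weighted s.toNNReal t.toNNReal x y h1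

/-- Dividing by the suprema reduces to supremum one; weighted AM-GM then replaces the arithmetic
mean of the integrals by the geometric one. -/
lemma prekopaLeindler_real_of_iSup_ne_top {s t : ℝ} (hs : 0 < s) (ht : 0 < t) (hst : s + t = 1)
    {f g h : ℝ → ℝ≥0∞} (hf : Measurable f) (hg : Measurable g) (hh : Measurable h)
    (hf1 : ⨆ x, f x ≠ ∞) (hg1 : ⨆ x, g x ≠ ∞)
    (H : ∀ x y, f x ^ s * g y ^ t ≤ h (s * x + t * y)) :
    (∫⁻ x, f x) ^ s * (∫⁻ x, g x) ^ t ≤ ∫⁻ x, h x := by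
  set M := ⨆ x, f x with hM
  set N := ⨆ x, g x with hN
  by_cases hM0 : M = 0
  · simp [ENNReal.iSup_eq_zero.1 (hM.symm.trans hM0), hs]
  by_cases hN0 : N = 0
  · simp [ENNReal.iSup_eq_zero.1 (hN.symm.trans hN0), ht]
  have hMs0 : M ^ s ≠ 0 := by simp [hM0, hf1]
  have hNt0 : N ^ t ≠ 0 := by simp [hN0, hg1]
  have hMs : M ^ s ≠ ∞ := by simp [hf1, hM0]
  have hNt : N ^ t ≠ ∞ := by simp [hg1, hN0]
  have key := prekopaLeindler_real_of_iSup_eq_one hs ht hst (f := fun x => M⁻¹ * f x)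
    (g := fun x => N⁻¹ * g x) (h := fun x => (M ^ s)⁻¹ * (N ^ t)⁻¹ * h x)
    (hf.const_mul _) (hg.const_mul _) (hh.const_mul _)
    (by rw [← ENNReal.mul_iSup, ENNReal.inv_mul_cancel hM0 hf1])
    (by rw [← ENNReal.mul_iSup, ENNReal.inv_mul_cancel hN0 hg1])
    (fun x y => by
      rw [ENNReal.mul_rpow_of_nonneg _ _ hs.le, ENNReal.mul_rpow_of_nonneg _ _ ht.le,
        ENNReal.inv_rpow, ENNReal.inv_rpow]
      calc _ = (M ^ s)⁻¹ * (N ^ t)⁻¹ * (f x ^ s * g y ^ t) := by ring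
        _ ≤ _ := by gcongr; exact H x y)
  rw [lintegral_const_mul _ hf, lintegral_const_mul _ hg, lintegral_const_mul _ hh] at key
  have key2 := (ENNReal.geom_mean_le_arith_mean2_ofReal hs ht hst _ _).trans key
  rw [ENNReal.mul_rpow_of_nonneg _ _ hs.le, ENNReal.mul_rpow_of_nonneg _ _ ht.le,
        ENNReal.inv_rpow, ENNReal.inv_rpow] at key2
  have hc : (M ^ s)⁻¹ * (N ^ t)⁻¹ ≠ 0 := by simp [hMs, hNt]
  have hc' : (M ^ s)⁻¹ * (N ^ t)⁻¹ ≠ ∞ := 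
    ENNReal.mul_ne_top (ENNReal.inv_ne_top.2 hMs0) (ENNReal.inv_ne_top.2 hNt0)
  rw [← ENNReal.mul_le_mul_iff_right hc hc']
  refine le_trans (le_of_eq ?_) key2
  ring

/-- The one-dimensional Prékopa-Leindler inequality. -/
lemma prekopaLeindler_real {s t : ℝ} (hs : 0 < s) (ht : 0 < t) (hst : s + t = 1)
    {f g h : ℝ → ℝ≥0∞} (hf : Measurable f) (hg : Measurable g) (hh : Measurable h)
    (H : ∀ x y, f x ^ s * g y ^ t ≤ h (s * x + t * y)) :
    (∫⁻ x, f x) ^ s * (∫⁻ x, g x) ^ t ≤ ∫⁻ x, h x := by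
  have trunc : ∀ {f : ℝ → ℝ≥0∞}, Measurable f → ∀ {s : ℝ}, 0 < s →
      (∫⁻ x, f x) ^ s = ⨆ k : ℕ, (∫⁻ x, min (f x) k) ^ s := by
    intro f hf s hs
    have h1 : ∫⁻ x, f x = ⨆ k : ℕ, ∫⁻ x, min (f x) k := by
      rw [← lintegral_iSup (fun k => hf.min measurable_const)
        (fun i j hij x => by dsimp only; gcongr)]
      congr 1
      ext x
      rw [← inf_iSup_eq, ENNReal.iSup_natCast, inf_top_eq]
    rw [h1]
    exact (ENNReal.orderIsoRpow s hs).map_iSup _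
  rw [trunc hf hs, trunc hg ht]
  simp only [ENNReal.iSup_mul, ENNReal.mul_iSup, iSup_le_iff]
  intro l k
  refine prekopaLeindler_real_of_iSup_ne_top hs ht hst (hf.min measurable_const)
    (hg.min measurable_const) hh ?_ ?_ fun x y => le_trans ?_ (H x y)
  · exact ((iSup_le fun x => min_le_right (f x) k).trans_lt (ENNReal.natCast_lt_top k)).ne
  · exact ((iSup_le fun x => min_le_right (g x) l).trans_lt (ENNReal.natCast_lt_top l)).ne
  · gcongr <;> exact min_le_left _ _

/-- The Prékopa-Leindler inequality. -/
theorem prekopaLeindler_pi {s t : ℝ} (hs : 0 < s) (ht : 0 < t) (hst : s + t = 1) :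
    ∀ (n : ℕ) {f g h : (Fin n → ℝ) → ℝ≥0∞} (_ : Measurable f) (_ : Measurable g)
      (_ : Measurable h) (_ : ∀ x y, f x ^ s * g y ^ t ≤ h (s • x + t • y)),
      (∫⁻ x, f x) ^ s * (∫⁻ x, g x) ^ t ≤ ∫⁻ x, h x
  | 0, f, g, h, _, _, _, H => by
    simp only [Measure.volume_pi_eq_dirac (0 : Fin 0 → ℝ), lintegral_dirac]
    exact (H 0 0).trans_eq (congrArg h (Subsingleton.elim _ _))
  | n + 1, f, g, h, hf, hg, hh, H => by
    set e := MeasurableEquiv.piFinSuccAbove (fun _ : Fin (n + 1) => ℝ) 0 with he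
    have hint : ∀ {f : (Fin (n + 1) → ℝ) → ℝ≥0∞}, Measurable f →
        ∫⁻ x, f x = ∫⁻ a : ℝ, ∫⁻ z : Fin n → ℝ, f (e.symm (a, z)) := by
      intro f hf
      rw [← ((volume_preserving_piFinSuccAbove (fun _ : Fin (n + 1) => ℝ) 0).symm e).lintegral_comp
        hf]
      exact lintegral_prod _ (hf.comp e.symm.measurable).aemeasurable
    have hmeas : ∀ {f : (Fin (n + 1) → ℝ) → ℝ≥0∞}, Measurable f →
        Measurable fun a : ℝ => ∫⁻ z : Fin n → ℝ, f (e.symm (a, z)) := fun hf =>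
      (hf.comp e.symm.measurable).lintegral_prod_right'
    rw [hint hf, hint hg, hint hh]
    -- The inductive hypothesis on slices is exactly the one-dimensional hypothesis for the slice
    -- integrals.
    refine prekopaLeindler_real hs ht hst (hmeas hf) (hmeas hg) (hmeas hh) fun a b => ?_
    refine prekopaLeindler_pi hs ht hst n ((hf.comp e.symm.measurable).comp measurable_prodMk_left)
      ((hg.comp e.symm.measurable).comp measurable_prodMk_left)
      ((hh.comp e.symm.measurable).comp measurable_prodMk_left) fun x y => ?_
    refine (H _ _).trans (le_of_eq ?_)
    refine congrArg h ?_
    ext i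
    refine Fin.cases ?_ (fun j => ?_) i <;>
      simp [he, MeasurableEquiv.piFinSuccAbove, Fin.insertNthEquiv]

/-- The Brunn-Minkowski inequality for two compact sets of volume at least `V`. -/
theorem le_volume_smul_add_smul {s t : ℝ} (hs : 0 < s) (ht : 0 < t) (hst : s + t = 1) {n : ℕ}
    {A B : Set (EuclideanSpace ℝ (Fin n))} (hA : IsCompact A) (hB : IsCompact B) {V : ℝ≥0∞}
    (hV : V ≠ ∞) (hVA : V ≤ volume A) (hVB : V ≤ volume B) : V ≤ volume (s • A + t • B) := by
  by_cases hV0 : V = 0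
  · simp [hV0]
  set e := (MeasurableEquiv.toLp 2 (Fin n → ℝ)) with he
  have hvol : ∀ {A : Set (EuclideanSpace ℝ (Fin n))}, IsCompact A →
      volume A = ∫⁻ x : Fin n → ℝ, A.indicator 1 (e x) := by
    intro A hA
    rw [← lintegral_indicator_one hA.measurableSet]
    exact ((PiLp.volume_preserving_toLp (Fin n)).lintegral_comp
      (measurable_one.indicator hA.measurableSet)).symm
  have hm : ∀ {A : Set (EuclideanSpace ℝ (Fin n))}, IsCompact A →
      Measurable fun x : Fin n → ℝ => A.indicator (1 : EuclideanSpace ℝ (Fin n) → ℝ≥0∞) (e x) := fun hA =>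
    (measurable_one.indicator hA.measurableSet).comp e.measurable
  have hAB : IsCompact (s • A + t • B) := (hA.smul s).add (hB.smul t)
  have key := prekopaLeindler_pi hs ht hst n (hm hA) (hm hB) (hm hAB) (fun x y => by
    by_cases hx : e x ∈ A
    · by_cases hy : e y ∈ B
      · have : e (s • x + t • y) ∈ s • A + t • B :=
          Set.add_mem_add (Set.smul_mem_smul_set hx) (Set.smul_mem_smul_set hy)
        simp [hx, hy, this]
      · simp [hy, ht]
    · simp [hx, hs])
  rw [← hvol hA, ← hvol hB, ← hvol hAB] at key
  refine le_trans ?_ key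
  calc V = V ^ s * V ^ t := by rw [← ENNReal.rpow_add _ _ hV0 hV, hst, ENNReal.rpow_one]
    _ ≤ _ := by gcongr

/-! ### The Gaussian distribution function. -/

section Gaussian

/-- The primitive of the density `exp (-π x ^ 2)` vanishing at the origin. -/
noncomputable def gaussianPrimitive (y : ℝ) : ℝ := ∫ x in (0 : ℝ)..y, Real.exp (-Real.pi * x ^ 2)

lemma hasDerivAt_gaussianPrimitive (y : ℝ) :
    HasDerivAt gaussianPrimitive (Real.exp (-Real.pi * y ^ 2)) y := by
  have hc : Continuous fun x : ℝ => Real.exp (-Real.pi * x ^ 2) := by fun_prop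
  exact intervalIntegral.integral_hasDerivAt_right (hc.intervalIntegrable _ _)
    (hc.stronglyMeasurableAtFilter _ _) hc.continuousAt

lemma strictMono_gaussianPrimitive : StrictMono gaussianPrimitive :=
  strictMono_of_hasDerivAt_pos hasDerivAt_gaussianPrimitive fun _ => Real.exp_pos _

lemma gaussianPrimitive_le (y : ℝ) : gaussianPrimitive y ≤ 1 / 2 := by
  rcases le_total y 0 with hy | hy
  · refine (strictMono_gaussianPrimitive.monotone hy).trans ?_
    simp [gaussianPrimitive]
  · have h := integral_gaussian_Ioi Real.pi
    rw [div_self Real.pi_pos.ne', Real.sqrt_one] at h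
    rw [← h, gaussianPrimitive, intervalIntegral.integral_of_le hy]
    refine setIntegral_mono_set (integrable_exp_neg_mul_sq Real.pi_pos).integrableOn
      (Filter.Eventually.of_forall fun x => (Real.exp_pos _).le) ?_
    exact (Set.Ioc_subset_Ioi_self).eventuallyLE

lemma gaussianPrimitive_neg (y : ℝ) : gaussianPrimitive (-y) = -gaussianPrimitive y := by
  have := intervalIntegral.integral_comp_neg (a := 0) (b := y)
    (fun x : ℝ => Real.exp (-Real.pi * x ^ 2))
  simp only [even_two.neg_pow, neg_zero] at this
  rw [gaussianPrimitive, gaussianPrimitive, this, intervalIntegral.integral_symm]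

lemma neg_le_gaussianPrimitive (y : ℝ) : -(1 / 2) ≤ gaussianPrimitive y := by
  have := gaussianPrimitive_le (-y)
  rw [gaussianPrimitive_neg] at this
  linarith

end Gaussian

/-! ### Decompositions of the identity. -/

section Decomposition

variable {E ι : Type*} [NormedAddCommGroup E] [InnerProductSpace ℝ E] [Fintype ι]
  {u : ι → E} {c : ι → ℝ}

lemma sum_mul_inner_sq_eq (hI : ∑ i, c i • rankOne ℝ (u i) (u i) = ContinuousLinearMap.id ℝ E)
    (x : E) : ∑ i, c i * ⟪u i, x⟫ ^ 2 = ‖x‖ ^ 2 := by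
  have h := congrArg (fun f : E →L[ℝ] E => ⟪f x, x⟫) hI
  simp only [sum_apply, smul_apply, rankOne_apply,
    ContinuousLinearMap.id_apply, sum_inner, real_inner_smul_left, real_inner_self_eq_norm_sq] at h
  rw [← h]
  exact Finset.sum_congr rfl fun i _ => by ring

variable [FiniteDimensional ℝ E]

/-- Trace of the decomposition of the identity. -/
lemma sum_eq_finrank (hu : ∀ i, ‖u i‖ = 1)
    (hI : ∑ i, c i • rankOne ℝ (u i) (u i) = ContinuousLinearMap.id ℝ E) :
    ∑ i, c i = Module.finrank ℝ E := by
  let b := stdOrthonormalBasis ℝ E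
  have h : ∑ j, ∑ i, c i * ⟪u i, b j⟫ ^ 2 = Module.finrank ℝ E := by
    simp [sum_mul_inner_sq_eq hI]
  rw [← h, Finset.sum_comm]
  refine Finset.sum_congr rfl fun i _ => ?_
  rw [← Finset.mul_sum]
  simp [b.sum_sq_inner_left, hu]

/-- Determinant inequality for a decomposition of the identity. -/
lemma prod_rpow_le_det (hu : ∀ i, ‖u i‖ = 1) (hc : ∀ i, 0 < c i)
    (hI : ∑ i, c i • rankOne ℝ (u i) (u i) = ContinuousLinearMap.id ℝ E)
    {t : ι → ℝ} (ht : ∀ i, 0 < t i) :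
    ∏ i, t i ^ c i ≤ (∑ i, (c i * t i) • rankOne ℝ (u i) (u i) : E →L[ℝ] E).det := by
  set A : E →L[ℝ] E := ∑ i, (c i * t i) • rankOne ℝ (u i) (u i) with hA
  have hAin : ∀ x y, ⟪A x, y⟫ = ∑ i, c i * t i * (⟪u i, x⟫ * ⟪u i, y⟫) := by
    intro x y
    simp [hA, sum_inner, real_inner_smul_left]
  have hsymm : (A : E →ₗ[ℝ] E).IsSymmetric := by
    intro x y
    simp only [ContinuousLinearMap.coe_coe]
    rw [hAin, real_inner_comm, hAin]
    exact Finset.sum_congr rfl fun i _ => by ring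
  let b := hsymm.eigenvectorBasis rfl
  have hev : ∀ j, hsymm.eigenvalues rfl j = ∑ i, c i * ⟪u i, b j⟫ ^ 2 * t i := by
    intro j
    have h1 : A (b j) = hsymm.eigenvalues rfl j • b j := hsymm.apply_eigenvectorBasis rfl j
    have h2 := hAin (b j) (b j)
    rw [h1, real_inner_smul_left, real_inner_self_eq_norm_sq, b.norm_eq_one] at h2
    rw [one_pow, mul_one] at h2
    rw [h2]
    exact Finset.sum_congr rfl fun i _ => by ring
  have hdet : A.det = ∏ j, hsymm.eigenvalues rfl j := by
    rw [ContinuousLinearMap.det, hsymm.det_eq_prod_eigenvalues rfl]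
    simp
  rw [hdet]
  -- The weights `c i * ⟪u i, b j⟫ ^ 2` sum to `c i` over `j` and to one over `i`, so weighted AM-GM
  -- bounds each eigenvalue from below.
  calc ∏ i, t i ^ c i = ∏ i, ∏ j, t i ^ (c i * ⟪u i, b j⟫ ^ 2) := by
        refine Finset.prod_congr rfl fun i _ => ?_
        rw [← Real.rpow_sum_of_pos (ht i), ← Finset.mul_sum]
        simp [b.sum_sq_inner_left, hu]
    _ = ∏ j, ∏ i, t i ^ (c i * ⟪u i, b j⟫ ^ 2) := Finset.prod_comm
    _ ≤ ∏ j, hsymm.eigenvalues rfl j := by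
        refine Finset.prod_le_prod
          (fun j _ => Finset.prod_nonneg fun i _ => (Real.rpow_pos_of_pos (ht i) _).le) fun j _ => ?_
        rw [hev]
        refine Real.geom_mean_le_arith_mean_weighted _ _ _
          (fun i _ => mul_nonneg (hc i).le (sq_nonneg _)) ?_ fun i _ => (ht i).le
        rw [sum_mul_inner_sq_eq hI, b.norm_eq_one, one_pow]

end Decomposition

/-! ### Zonotopes and the lower bound for their volume. -/

section Zonotope

variable {E ι : Type*} [NormedAddCommGroup E] [InnerProductSpace ℝ E]

/-- The Minkowski sum of the segments `[-l i • u i, l i • u i]` for `i ∈ s`. -/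
def zonotope (s : Finset ι) (u : ι → E) (l : ι → ℝ) : Set E :=
  ∑ i ∈ s, (fun r : ℝ => r • u i) '' Set.Icc (-l i) (l i)

lemma isCompact_zonotope (s : Finset ι) (u : ι → E) (l : ι → ℝ) :
    IsCompact (zonotope s u l) := by
  classical
  induction s using Finset.induction_on with
  | empty => simp [zonotope, ← Set.singleton_zero]
  | insert i s hi ih =>
    rw [zonotope, Finset.sum_insert hi]
    exact (isCompact_Icc.image (by fun_prop)).add ih

lemma convex_zonotope (s : Finset ι) (u : ι → E) (l : ι → ℝ) : Convex ℝ (zonotope s u l) :=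
  convex_sum _ fun i _ => (convex_Icc _ _).linear_image (LinearMap.toSpanSingleton ℝ E (u i))

lemma smul_zonotope (s : Finset ι) (u : ι → E) (l : ι → ℝ) {r : ℝ} (hr : 0 < r) :
    r • zonotope s u l = zonotope s u fun i => r * l i := by
  simp only [zonotope, Finset.smul_sum]
  refine Finset.sum_congr rfl fun i _ => ?_
  ext x
  constructor
  · rintro ⟨_, ⟨y, ⟨h1, h2⟩, rfl⟩, rfl⟩
    exact ⟨r * y, ⟨by nlinarith, by nlinarith⟩, by simp [mul_smul]⟩
  · rintro ⟨y, ⟨h1, h2⟩, rfl⟩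
    refine ⟨(y / r) • u i, ⟨y / r, ⟨?_, ?_⟩, rfl⟩, ?_⟩
    · rw [le_div_iff₀ hr]; linarith
    · rw [div_le_iff₀ hr]; linarith
    · simp only [smul_smul]
      rw [mul_div_cancel₀ _ hr.ne']

variable [Fintype ι] [FiniteDimensional ℝ E] [MeasurableSpace E] [BorelSpace E]
  {u : ι → E} {c : ι → ℝ}

/-- Lower bound for the volume of a zonotope, by transporting the Gaussian measure into it. -/
theorem prod_rpow_le_volume_zonotope (hu : ∀ i, ‖u i‖ = 1) (hc : ∀ i, 0 < c i)
    (hI : ∑ i, c i • rankOne ℝ (u i) (u i) = ContinuousLinearMap.id ℝ E)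
    {a : ι → ℝ} (ha : ∀ i, 0 < a i) :
    ENNReal.ofReal (∏ i, (2 * a i) ^ c i) ≤
      volume (zonotope Finset.univ u fun i => c i * a i) := by
  set T : ι → ℝ → ℝ := fun i y => 2 * a i * gaussianPrimitive y with hT
  set Φ : E → E := fun y => ∑ i, (c i * T i ⟪u i, y⟫) • u i with hΦ
  set D : E → ι → ℝ := fun y i => 2 * a i * Real.exp (-Real.pi * ⟪u i, y⟫ ^ 2) with hD
  -- `T i` maps the line into `[-a i, a i]` with derivative `D y i` at `⟪u i, y⟫`, so `Φ` lands in
  -- the zonotope.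
  have hDpos : ∀ y i, 0 < D y i := fun y i => mul_pos (mul_pos two_pos (ha i)) (Real.exp_pos _)
  have hderiv : ∀ y, HasFDerivAt Φ (∑ i, (c i * D y i) • rankOne ℝ (u i) (u i) : E →L[ℝ] E) y := by
    intro y
    refine HasFDerivAt.fun_sum fun i _ => ?_
    have h1 : HasFDerivAt (fun y : E => ⟪u i, y⟫) (innerSL ℝ (u i)) y :=
      (innerSL ℝ (u i)).hasFDerivAt
    have h2 := ((((hasDerivAt_gaussianPrimitive ⟪u i, y⟫).const_mul (2 * a i)).const_mul
      (c i)).comp_hasFDerivAt y h1).smul_const (u i)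
    refine h2.congr_fderiv ?_
    ext1 z
    simp [hD, smul_smul]
  have hinj : Function.Injective Φ := by
    intro x y hxy
    have h1 : ∑ i, c i * ((T i ⟪u i, x⟫ - T i ⟪u i, y⟫) * (⟪u i, x⟫ - ⟪u i, y⟫)) = 0 := by
      have : ⟪Φ x - Φ y, x - y⟫ = 0 := by rw [hxy, sub_self, inner_zero_left]
      rw [← this]
      simp only [hΦ, ← Finset.sum_sub_distrib, ← sub_smul, sum_inner, real_inner_smul_left,
        inner_sub_right]
      exact Finset.sum_congr rfl fun i _ => by ring
    have hmono : ∀ i, StrictMono (T i) := fun i =>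
      strictMono_gaussianPrimitive.const_mul (mul_pos two_pos (ha i))
    have h2 : ∀ i, 0 ≤ c i * ((T i ⟪u i, x⟫ - T i ⟪u i, y⟫) * (⟪u i, x⟫ - ⟪u i, y⟫)) := by
      intro i
      refine mul_nonneg (hc i).le ?_
      rcases le_total ⟪u i, x⟫ ⟪u i, y⟫ with h | h
      · exact mul_nonneg_of_nonpos_of_nonpos (sub_nonpos.2 ((hmono i).monotone h))
          (sub_nonpos.2 h)
      · exact mul_nonneg (sub_nonneg.2 ((hmono i).monotone h)) (sub_nonneg.2 h)
    have h3 : ∀ i, ⟪u i, x - y⟫ = 0 := by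
      intro i
      have := (Finset.sum_eq_zero_iff_of_nonneg fun i _ => h2 i).1 h1 i (Finset.mem_univ i)
      rw [inner_sub_right]
      rcases mul_eq_zero.1 this with h | h
      · exact absurd h (hc i).ne'
      rcases mul_eq_zero.1 h with h | h
      · rw [(hmono i).injective (sub_eq_zero.1 h), sub_self]
      · exact h
    have h4 := sum_mul_inner_sq_eq hI (x - y)
    simp only [h3] at h4
    simpa [sub_eq_zero] using h4.symm
  have himage : Φ '' Set.univ ⊆ zonotope Finset.univ u fun i => c i * a i := by
    rintro _ ⟨y, -, rfl⟩
    refine Set.finsetSum_mem_finsetSum _ _ _ fun i _ => ⟨c i * T i ⟪u i, y⟫, ?_, rfl⟩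
    have h1 := gaussianPrimitive_le ⟪u i, y⟫
    have h2 := neg_le_gaussianPrimitive ⟪u i, y⟫
    constructor
    · rw [← mul_neg]
      refine mul_le_mul_of_nonneg_left ?_ (hc i).le
      simp only [hT]
      nlinarith [ha i]
    · refine mul_le_mul_of_nonneg_left ?_ (hc i).le
      simp only [hT]
      nlinarith [ha i]
  -- Since `∑ c i * ⟪u i, y⟫ ^ 2 = ‖y‖ ^ 2`, the one-dimensional densities multiply to the Gaussian
  -- of total mass one.
  have hprod : ∀ y, ∏ i, D y i ^ c i
      = (∏ i, (2 * a i) ^ c i) * Real.exp (-Real.pi * ‖y‖ ^ 2) := by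
    intro y
    rw [← sum_mul_inner_sq_eq hI y, Finset.mul_sum, Real.exp_sum, ← Finset.prod_mul_distrib]
    refine Finset.prod_congr rfl fun i _ => ?_
    rw [Real.mul_rpow (mul_pos two_pos (ha i)).le (Real.exp_pos _).le, ← Real.exp_mul]
    congr 2
    ring
  have hgauss : ∫⁻ y : E, ENNReal.ofReal (Real.exp (-Real.pi * ‖y‖ ^ 2)) = 1 := by
    have h := GaussianFourier.integral_rexp_neg_mul_sq_norm (V := E) Real.pi_pos
    rw [div_self Real.pi_pos.ne', Real.one_rpow] at h
    rw [← ofReal_integral_eq_lintegral_ofReal _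
      (Filter.Eventually.of_forall fun x => (Real.exp_pos _).le), h, ENNReal.ofReal_one]
    exact Integrable.of_integral_ne_zero (by rw [h]; exact one_ne_zero)
  have hpos : 0 ≤ ∏ i, (2 * a i) ^ c i :=
    Finset.prod_nonneg fun i _ => Real.rpow_nonneg (mul_pos two_pos (ha i)).le _
  calc ENNReal.ofReal (∏ i, (2 * a i) ^ c i)
      = ∫⁻ y : E, ENNReal.ofReal (∏ i, D y i ^ c i) := by
        simp only [hprod, ENNReal.ofReal_mul hpos]
        rw [lintegral_const_mul' _ _ ENNReal.ofReal_ne_top, hgauss, mul_one]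
    _ ≤ ∫⁻ y in Set.univ, ENNReal.ofReal
          |(∑ i, (c i * D y i) • rankOne ℝ (u i) (u i) : E →L[ℝ] E).det| := by
        rw [Measure.restrict_univ]
        refine lintegral_mono fun y => ENNReal.ofReal_le_ofReal ?_
        exact (prod_rpow_le_det hu hc hI (hDpos y)).trans (le_abs_self _)
    _ = volume (Φ '' Set.univ) := lintegral_abs_det_fderiv_eq_addHaar_image volume
        MeasurableSet.univ (fun y _ => (hderiv y).hasFDerivWithinAt) hinj.injOn
    _ ≤ _ := measure_mono himage

end Zonotope

/-! ### Fibres over a hyperplane and the effect of adding segments. -/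

section Fiber

variable {E : Type*} [NormedAddCommGroup E] [InnerProductSpace ℝ E] {u : E}

lemma orthogonalProjectionOnto_add_smul (y : (ℝ ∙ u)ᗮ) (r : ℝ) :
    (ℝ ∙ u)ᗮ.orthogonalProjectionOnto ((y : E) + r • u) = y := by
  have h : (ℝ ∙ u)ᗮ.orthogonalProjectionOnto u = 0 :=
    Submodule.orthogonalProjectionOnto_orthogonalComplement_singleton_eq_zero u
  simp [h]

variable [FiniteDimensional ℝ E] [MeasurableSpace E] [BorelSpace E]

lemma measurePreserving_add_smul (hu : ‖u‖ = 1) :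
    MeasurePreserving (fun p : (ℝ ∙ u)ᗮ × ℝ => (p.1 : E) + p.2 • u) volume volume := by
  have h1 : MeasurePreserving (Prod.swap : (ℝ ∙ u)ᗮ × ℝ → ℝ × (ℝ ∙ u)ᗮ) volume volume :=
    Measure.measurePreserving_swap
  have h2 : MeasurePreserving
      (Prod.map (LinearIsometryEquiv.toSpanUnitSingleton (𝕜 := ℝ) u hu) (id : (ℝ ∙ u)ᗮ → _))
      volume volume :=
    (LinearIsometryEquiv.measurePreserving _).prod (MeasurePreserving.id _)
  have h3 := WithLp.volume_preserving_toLp (ℝ ∙ u) (ℝ ∙ u)ᗮ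
  have h4 := (ℝ ∙ u).orthogonalDecomposition.symm.measurePreserving
  have h5 : ∀ q : WithLp 2 ((ℝ ∙ u) × (ℝ ∙ u)ᗮ),
      (ℝ ∙ u).orthogonalDecomposition.symm q = (q.fst : E) + (q.snd : E) := fun _ => rfl
  have h6 : (fun p : (ℝ ∙ u)ᗮ × ℝ => (p.1 : E) + p.2 • u) = (ℝ ∙ u).orthogonalDecomposition.symm ∘
      WithLp.toLp 2 ∘ Prod.map (LinearIsometryEquiv.toSpanUnitSingleton (𝕜 := ℝ) u hu) id ∘
        Prod.swap := by
    funext p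
    simp [h5, add_comm]
  rw [h6]
  exact h4.comp (h3.comp (h2.comp h1))

lemma volume_eq_lintegral_fiber (hu : ‖u‖ = 1) {K : Set E} (hK : MeasurableSet K) :
    volume K = ∫⁻ y : (ℝ ∙ u)ᗮ, volume {r : ℝ | (y : E) + r • u ∈ K} := by
  have h := measurePreserving_add_smul hu
  rw [← h.measure_preimage hK.nullMeasurableSet]
  exact Measure.prod_apply (h.measurable hK)

lemma volume_eq_zero_of_volume_image_eq_zero (hu : ‖u‖ = 1) {K : Set E} (hK : MeasurableSet K)
    (h : volume ((ℝ ∙ u)ᗮ.orthogonalProjectionOnto '' K) = 0) : volume K = 0 := by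
  rw [volume_eq_lintegral_fiber hu hK]
  refine lintegral_eq_zero_of_ae_eq_zero ?_
  filter_upwards [measure_eq_zero_iff_ae_notMem.1 h] with y hy
  rw [show {r : ℝ | (y : E) + r • u ∈ K} = ∅ from ?_]
  · simp
  rw [Set.eq_empty_iff_forall_notMem]
  intro r hr
  exact hy ⟨_, hr, orthogonalProjectionOnto_add_smul y r⟩

/-- By convexity each nonempty fibre of `K` along `u` is an interval; adding the segment lengthens
it by `2 * d` and creates no fibre outside the shadow of `K`. -/
lemma volume_segment_add_le (hu : ‖u‖ = 1) {K : Set E} (hK : IsCompact K) (hK' : Convex ℝ K)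
    {d : ℝ} (hd : 0 ≤ d) :
    volume ((fun r : ℝ => r • u) '' Set.Icc (-d) d + K) ≤
      volume K + ENNReal.ofReal (2 * d) *
        volume ((ℝ ∙ u)ᗮ.orthogonalProjectionOnto '' K) := by
  set P := (ℝ ∙ u)ᗮ.orthogonalProjectionOnto with hP
  have hPK : MeasurableSet (P '' K) := (hK.image P.continuous).measurableSet
  have hS : IsCompact ((fun r : ℝ => r • u) '' Set.Icc (-d) d + K) :=
    (isCompact_Icc.image (by fun_prop)).add hK
  rw [volume_eq_lintegral_fiber hu hS.measurableSet, volume_eq_lintegral_fiber hu hK.measurableSet,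
    ← lintegral_indicator_one hPK, ← lintegral_const_mul' _ _ ENNReal.ofReal_ne_top,
    ← lintegral_add_right _ ((measurable_one.indicator hPK).const_mul _)]
  refine lintegral_mono fun y => ?_
  set F := {r : ℝ | (y : E) + r • u ∈ K} with hF
  have hsub : ∀ r : ℝ, (y : E) + r • u ∈ (fun r : ℝ => r • u) '' Set.Icc (-d) d + K →
      ∃ q ∈ F, q - d ≤ r ∧ r ≤ q + d := by
    rintro r ⟨_, ⟨q, hq, rfl⟩, k, hk, hqk⟩
    refine ⟨r - q, ?_, by
      obtain ⟨h1, h2⟩ := hq; linarith, by obtain ⟨h1, h2⟩ := hq; linarith⟩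
    have : (y : E) + (r - q) • u = k := by
      rw [sub_smul, ← add_sub_assoc, ← hqk]
      simp
    rw [hF, Set.mem_ofPred_eq, this]
    exact hk
  rcases F.eq_empty_or_nonempty with hF0 | hF0
  · rw [show {r : ℝ | (y : E) + r • u ∈ (fun r : ℝ => r • u) '' Set.Icc (-d) d + K} = ∅ from ?_]
    · simp
    rw [Set.eq_empty_iff_forall_notMem]
    intro r hr
    obtain ⟨q, hq, -⟩ := hsub r hr
    simp [hF0] at hq
  have hy : y ∈ P '' K := by
    obtain ⟨r, hr⟩ := hF0
    exact ⟨_, hr, orthogonalProjectionOnto_add_smul y r⟩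
  have hFconv : Convex ℝ F := by
    intro a ha b hb s t hs ht hst
    have := hK' ha hb hs ht hst
    rw [hF, Set.mem_ofPred_eq]
    convert this using 1
    rw [smul_add, smul_add, smul_smul, smul_smul, add_add_add_comm, ← add_smul, hst, one_smul,
      ← add_smul]
    rfl
  have hFcomp : IsCompact F := by
    refine Metric.isCompact_of_isClosed_isBounded
      (hK.isClosed.preimage (by fun_prop : Continuous fun r : ℝ => (y : E) + r • u)) ?_
    obtain ⟨R, hR⟩ := hK.isBounded.exists_norm_le
    refine isBounded_iff_forall_norm_le.2 ⟨R + ‖(y : E)‖, fun r hr => ?_⟩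
    calc ‖r‖ = ‖((y : E) + r • u) - y‖ := by simp [norm_smul, hu]
      _ ≤ ‖(y : E) + r • u‖ + ‖(y : E)‖ := norm_sub_le _ _
      _ ≤ R + ‖(y : E)‖ := by gcongr; exact hR _ hr
  have hFicc := eq_Icc_of_connected_compact
    ⟨hF0, hFconv.isPreconnected⟩ hFcomp
  set a := sInf F
  set b := sSup F
  have hab : a ≤ b := by
    obtain ⟨r, hr⟩ := hF0
    rw [hFicc] at hr
    exact hr.1.trans hr.2
  calc volume {r : ℝ | (y : E) + r • u ∈ (fun r : ℝ => r • u) '' Set.Icc (-d) d + K}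
      ≤ volume (Set.Icc (a - d) (b + d)) := by
        refine measure_mono fun r hr => ?_
        obtain ⟨q, hq, h1, h2⟩ := hsub r hr
        rw [hFicc] at hq
        exact ⟨by linarith [hq.1], by linarith [hq.2]⟩
    _ = volume F + ENNReal.ofReal (2 * d) * (P '' K).indicator 1 y := by
        rw [hFicc, Real.volume_Icc, Real.volume_Icc, Set.indicator_of_mem hy, Pi.one_apply, mul_one,
          ← ENNReal.ofReal_add (by linarith) (by linarith)]
        congr 1
        ring

variable {ι : Type*}

/-- Segments are added one at a time, and each intermediate shadow is enlarged to the final one. -/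
lemma volume_add_zonotope_le {K : Set E} (hK : IsCompact K) (hK' : Convex ℝ K) {u : ι → E}
    (hu : ∀ i, ‖u i‖ = 1) {l : ι → ℝ} (hl : ∀ i, 0 ≤ l i) (s : Finset ι) :
    volume (K + zonotope s u l) ≤ volume K + ∑ i ∈ s, ENNReal.ofReal (2 * l i) *
      volume ((ℝ ∙ u i)ᗮ.orthogonalProjectionOnto '' (K + zonotope s u l)) := by
  classical
  induction s using Finset.induction_on with
  | empty => simp [zonotope]
  | insert i s hi ih =>
    have heq : K + zonotope (insert i s) u l
        = (fun r : ℝ => r • u i) '' Set.Icc (-l i) (l i) + (K + zonotope s u l) := by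
      rw [zonotope, Finset.sum_insert hi, add_left_comm]
      rfl
    have hsub : K + zonotope s u l ⊆ K + zonotope (insert i s) u l := by
      rw [heq]
      intro x hx
      exact ⟨0, ⟨0, ⟨by simpa using hl i, hl i⟩, by simp⟩, x, hx, zero_add x⟩
    have hstep := volume_segment_add_le (hu i) (hK.add (isCompact_zonotope s u l))
      (hK'.add (convex_zonotope s u l)) (hl i)
    rw [← heq] at hstep
    rw [Finset.sum_insert hi]
    calc _ ≤ _ := hstep
      _ ≤ (volume K + ∑ j ∈ s, ENNReal.ofReal (2 * l j) *
            volume ((ℝ ∙ u j)ᗮ.orthogonalProjectionOnto '' (K + zonotope s u l)))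
          + ENNReal.ofReal (2 * l i) *
            volume ((ℝ ∙ u i)ᗮ.orthogonalProjectionOnto '' (K + zonotope s u l)) := by gcongr
      _ ≤ (volume K + ∑ j ∈ s, ENNReal.ofReal (2 * l j) *
            volume ((ℝ ∙ u j)ᗮ.orthogonalProjectionOnto '' (K + zonotope (insert i s) u l)))
          + ENNReal.ofReal (2 * l i) *
            volume ((ℝ ∙ u i)ᗮ.orthogonalProjectionOnto '' (K + zonotope (insert i s) u l)) := by
        gcongr
      _ = _ := by rw [add_assoc, add_comm (∑ j ∈ s, _)]

end Fiber

/-! ### Minkowski's first inequality and the conclusion. -/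

/-- Minkowski's first inequality for a convex set and a zonotope of at least the same volume. -/
theorem natCast_mul_volume_le_sum_of_volume_le_volume_zonotope {n : ℕ} {ι : Type*} [Fintype ι]
    {C : Set (EuclideanSpace ℝ (Fin n))} (hC : IsCompact C) (hC' : Convex ℝ C)
    {u : ι → EuclideanSpace ℝ (Fin n)} (hu : ∀ i, ‖u i‖ = 1) {l : ι → ℝ} (hl : ∀ i, 0 ≤ l i)
    (h : volume C ≤ volume (zonotope Finset.univ u l)) :
    n * volume C ≤ ∑ i, ENNReal.ofReal (2 * l i) *
      volume ((ℝ ∙ u i)ᗮ.orthogonalProjectionOnto '' C) := by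
  set Z := zonotope Finset.univ u l with hZ
  have hZc : IsCompact Z := isCompact_zonotope _ _ _
  obtain ⟨R, hR⟩ := hZc.isBounded.exists_norm_le
  have hCtop : volume C ≠ ∞ := hC.measure_ne_top
  have hlower : ∀ r : ℝ, 0 < r →
      volume C + ENNReal.ofReal r * (n * volume C) ≤ volume (C + r • Z) := by
    intro r hr
    have hr1 : 0 < 1 + r := by linarith
    -- These weights turn the convex combination into `(1 + r)⁻¹ • (C + r • Z)`; Bernoulli's
    -- inequality then linearises `(1 + r) ^ n`.
    have h1 := le_volume_smul_add_smul (s := (1 + r)⁻¹) (t := (1 + r)⁻¹ * r) (by positivity)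
      (by positivity) (by field_simp) hC hZc hCtop le_rfl h
    rw [mul_smul, ← smul_add, Measure.addHaar_smul, finrank_euclideanSpace_fin,
      abs_of_pos (by positivity)] at h1
    calc volume C + ENNReal.ofReal r * (n * volume C)
        = ENNReal.ofReal (1 + n * r) * volume C := by
          rw [ENNReal.ofReal_add zero_le_one (by positivity), ENNReal.ofReal_mul (by positivity),
            ENNReal.ofReal_one, ENNReal.ofReal_natCast]
          ring
      _ ≤ ENNReal.ofReal ((1 + r) ^ n) *
            (ENNReal.ofReal ((1 + r)⁻¹ ^ n) * volume (C + r • Z)) := by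
          gcongr
          exact one_add_mul_le_pow (by linarith) n
      _ = volume (C + r • Z) := by
          rw [← mul_assoc, ← ENNReal.ofReal_mul (by positivity), ← mul_pow,
            mul_inv_cancel₀ hr1.ne', one_pow, ENNReal.ofReal_one, one_mul]
  have hupper : ∀ r : ℝ, 0 < r → n * volume C ≤ ∑ i, ENNReal.ofReal (2 * l i) *
      volume (Metric.cthickening (r * R) ((ℝ ∙ u i)ᗮ.orthogonalProjectionOnto '' C)) := by
    intro r hr
    have h1 := volume_add_zonotope_le hC hC' hu (l := fun i => r * l i)
      (fun i => mul_nonneg hr.le (hl i)) Finset.univ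
    rw [← smul_zonotope _ _ _ hr, ← hZ] at h1
    have h2 := (ENNReal.add_le_add_iff_left hCtop).1 ((hlower r hr).trans h1)
    rw [← ENNReal.mul_le_mul_iff_right (a := ENNReal.ofReal r) (by simpa) ENNReal.ofReal_ne_top,
      Finset.mul_sum]
    refine h2.trans (Finset.sum_le_sum fun i _ => ?_)
    rw [← mul_assoc (ENNReal.ofReal r), ← ENNReal.ofReal_mul hr.le, mul_left_comm r]
    gcongr
    -- Projections do not increase norms, so the shadow of `C + r • Z` stays within `r * R` of that
    -- of `C`.
    rintro _ ⟨_, ⟨x, hx, _, ⟨z, hz, rfl⟩, rfl⟩, rfl⟩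
    refine Metric.mem_cthickening_of_dist_le _ _ _ _ ⟨x, hx, rfl⟩ ?_
    rw [dist_eq_norm, ← map_sub, add_sub_cancel_left]
    refine (Submodule.norm_orthogonalProjectionOnto_apply_le _ _).trans ?_
    rw [norm_smul, Real.norm_of_nonneg hr.le]
    gcongr
    exact hR z hz
  have hlim : Filter.Tendsto (fun r : ℝ => ∑ i, ENNReal.ofReal (2 * l i) *
      volume (Metric.cthickening (r * R) ((ℝ ∙ u i)ᗮ.orthogonalProjectionOnto '' C)))
      (nhdsWithin 0 (Set.Ioi 0)) (nhds (∑ i, ENNReal.ofReal (2 * l i) *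
      volume ((ℝ ∙ u i)ᗮ.orthogonalProjectionOnto '' C))) := by
    refine tendsto_finsetSum _ fun i _ => ?_
    refine ENNReal.Tendsto.const_mul ?_ (Or.inr ENNReal.ofReal_ne_top)
    refine (tendsto_measure_cthickening_of_isCompact
      (hC.image (ContinuousLinearMap.continuous _))).comp ?_
    refine tendsto_nhdsWithin_of_tendsto_nhds ?_
    exact Continuous.tendsto' (by fun_prop) _ _ (zero_mul R)
  refine ge_of_tendsto hlim ?_
  filter_upwards [self_mem_nhdsWithin] with r hr using hupper r hr

lemma one_le_volume_of_finrank_eq_zero {F : Type*} [NormedAddCommGroup F] [InnerProductSpace ℝ F]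
    [FiniteDimensional ℝ F] [MeasurableSpace F] [BorelSpace F] (hF : Module.finrank ℝ F = 0)
    {s : Set F} (hs : s.Nonempty) : 1 ≤ volume s := by
  have := Module.finrank_zero_iff.1 hF
  rw [Subsingleton.eq_univ_of_nonempty hs, ← (stdOrthonormalBasis ℝ F).volume_parallelepiped]
  exact measure_mono (Set.subset_univ _)

theorem volume_pow_le_prod_volume_image_of_ne_zero {n : ℕ} {ι : Type*} [Fintype ι]
    {C : Set (EuclideanSpace ℝ (Fin n))} (hC : IsCompact C) (hC' : Convex ℝ C)
    {u : ι → EuclideanSpace ℝ (Fin n)} {c : ι → ℝ}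
    (hu : ∀ i, ‖u i‖ = 1) (hc : ∀ i, 0 < c i)
    (hI : ∑ i, c i • rankOne ℝ (u i) (u i) =
      ContinuousLinearMap.id ℝ (EuclideanSpace ℝ (Fin n))) (hn : n ≠ 0) (h0 : volume C ≠ 0) :
    volume C ^ (n - 1) ≤
      ∏ i, volume ((ℝ ∙ u i)ᗮ.orthogonalProjectionOnto '' C) ^ c i := by
  have hsum : ∑ i, c i = n := by
    simpa using sum_eq_finrank hu hI
  have hPtop : ∀ i, volume ((ℝ ∙ u i)ᗮ.orthogonalProjectionOnto '' C) ≠ ∞ := fun i =>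
    (hC.image (ContinuousLinearMap.continuous _)).measure_ne_top
  have hP0 : ∀ i, volume ((ℝ ∙ u i)ᗮ.orthogonalProjectionOnto '' C) ≠ 0 := fun i h =>
    h0 (volume_eq_zero_of_volume_image_eq_zero (hu i) hC.measurableSet h)
  set p : ι → ℝ := fun i => (volume ((ℝ ∙ u i)ᗮ.orthogonalProjectionOnto '' C)).toReal with hp
  have hpV : ∀ i, volume ((ℝ ∙ u i)ᗮ.orthogonalProjectionOnto '' C) = ENNReal.ofReal (p i) :=
    fun i => (ENNReal.ofReal_toReal (hPtop i)).symm
  have hp0 : ∀ i, 0 < p i := fun i => ENNReal.toReal_pos (hP0 i) (hPtop i)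
  obtain ⟨V, hV0, hV⟩ : ∃ V : ℝ, 0 < V ∧ volume C = ENNReal.ofReal V :=
    ⟨_, ENNReal.toReal_pos h0 hC.measure_ne_top, (ENNReal.ofReal_toReal hC.measure_ne_top).symm⟩
  set Q := ∏ i, p i ^ c i with hQ
  have hQ0 : 0 < Q := Finset.prod_pos fun i _ => Real.rpow_pos_of_pos (hp0 i) _
  obtain ⟨k, hk0, hk⟩ : ∃ k : ℝ, 0 < k ∧ k ^ n = V * Q :=
    ⟨(V * Q) ^ (n⁻¹ : ℝ), by positivity, Real.rpow_inv_natCast_pow (by positivity) hn⟩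
  -- This makes `∏ (2 * a i) ^ c i = k ^ n / Q = V` and each summand in Minkowski's inequality equal
  -- to `c i * k`.
  set a : ι → ℝ := fun i => k / (2 * p i) with ha
  have ha0 : ∀ i, 0 < a i := fun i => div_pos hk0 (mul_pos two_pos (hp0 i))
  have hprod : ∏ i, (2 * a i) ^ c i = V := by
    have : ∀ i, (2 * a i) ^ c i = k ^ c i / p i ^ c i := fun i => by
      rw [← Real.div_rpow hk0.le (hp0 i).le]
      congr 1
      have := (hp0 i).ne'
      simp only [ha]
      field_simp
    simp only [this]
    rw [Finset.prod_div_distrib, ← Real.rpow_sum_of_pos hk0, hsum, Real.rpow_natCast, hk,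
      mul_div_cancel_right₀ _ hQ0.ne']
  have hzon := prod_rpow_le_volume_zonotope hu hc hI ha0
  rw [hprod, ← hV] at hzon
  have key := natCast_mul_volume_le_sum_of_volume_le_volume_zonotope hC hC' hu
    (fun i => (mul_pos (hc i) (ha0 i)).le) hzon
  have hterm : ∀ i, ENNReal.ofReal (2 * (c i * a i)) *
      volume ((ℝ ∙ u i)ᗮ.orthogonalProjectionOnto '' C) = ENNReal.ofReal (c i * k) := fun i => by
    rw [hpV, ← ENNReal.ofReal_mul (by have := hc i; have := ha0 i; positivity)]
    congr 1
    have := (hp0 i).ne'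
    simp only [ha]
    field_simp
  simp only [hterm] at key
  rw [← ENNReal.ofReal_sum_of_nonneg fun i _ => (mul_pos (hc i) hk0).le, ← Finset.sum_mul, hsum,
    hV, ← ENNReal.ofReal_natCast, ← ENNReal.ofReal_mul (Nat.cast_nonneg n),
    ENNReal.ofReal_le_ofReal_iff (by positivity)] at key
  have hVk : V ≤ k := le_of_mul_le_mul_left key (by positivity)
  have hfin : V ^ (n - 1) ≤ Q := by
    refine le_of_mul_le_mul_left ?_ hV0
    rw [← hk, mul_pow_sub_one hn]
    exact pow_le_pow_left₀ hV0.le hVk n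
  simp only [hpV]
  rw [hV, ← ENNReal.ofReal_pow hV0.le,
    Finset.prod_congr rfl fun i _ => ENNReal.ofReal_rpow_of_pos (hp0 i),
    ← ENNReal.ofReal_prod_of_nonneg fun i _ => (Real.rpow_pos_of_pos (hp0 i) _).le]
  exact ENNReal.ofReal_le_ofReal hfin

theorem theorem3 (n m : ℕ) (C : ConvexBody (EuclideanSpace ℝ (Fin n)))
    (u : Fin m → EuclideanSpace ℝ (Fin n)) (c : Fin m → ℝ)
    (hu : ∀ i, ‖u i‖ = 1) (hc : ∀ i, 0 < c i)
    (hI : ∑ i, c i • rankOne ℝ (u i) (u i) =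
      ContinuousLinearMap.id ℝ (EuclideanSpace ℝ (Fin n))) :
    volume (C : Set (EuclideanSpace ℝ (Fin n))) ^ (n - 1) ≤
      ∏ i, volume ((ℝ ∙ u i)ᗮ.orthogonalProjectionOnto ''
        (C : Set (EuclideanSpace ℝ (Fin n)))) ^ c i := by
  rcases Nat.lt_or_ge 1 n with hn | hn
  · by_cases h0 : volume (C : Set (EuclideanSpace ℝ (Fin n))) = 0
    · simp [h0, Nat.sub_ne_zero_of_lt hn]
    · exact volume_pow_le_prod_volume_image_of_ne_zero C.isCompact C.convex hu hc hI (by omega) h0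
  -- For `n ≤ 1` the left side is one, and each shadow is a nonempty set in a zero-dimensional
  -- space, where volume counts points.
  · rw [Nat.sub_eq_zero_of_le hn, pow_zero]
    refine Finset.one_le_prod' fun i _ => ENNReal.one_le_rpow ?_ (hc i)
    refine one_le_volume_of_finrank_eq_zero ?_ (C.nonempty.image _)
    have hui : u i ≠ 0 := fun h => by simpa [h] using hu i
    have h1 := (ℝ ∙ u i).finrank_add_finrank_orthogonal
    rw [finrank_span_singleton hui, finrank_euclideanSpace_fin] at h1
    omega
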